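/- **Setting.** Let $0<\alpha\le 1$, let $k\ge1$ and $n_0\ge 0$ be integers, and let $\lambda_{(n)_i}>0$ for $n\ge n_0$, $1\le i\le k$. The generalized fractional birth process (GFBP) is a process $\{\mathcal X^\alpha(t)\}_{t\ge0}$ with states $n_0,n_0+1,\dots$ (possibly with an additional state $\infty$ reached by explosion) whose state probabilities $p^\alpha(n,t)=\Pr\{\mathcal X^\alpha(t)=n\}$ are, for each $n\ge n_0$, locally absolutely continuous in $t\in[0,\infty)$ and satisfy, for $t>0$, $$\frac{\mathrm d^\alpha}{\mathrm dt^\alpha}p^\alpha(n,t)=-\sum_{i=1}^k\lambda_{(n)_i}\,p^\alpha(n,t)+\sum_{i=1}^{\min\{n,k\}}\lambda_{(n-i)_i}\,p^\alpha(n-i,t),\qquad n\ge n_0,$$ with $p^\alpha(n_0,0)=1$ and $p^\alpha(n,0)=0$ for $n>n_0$ (and $p^\alpha(n,t)=0$ for $n<n_0$, where the corresponding terms are read as $0$). Here $\frac{\mathrm d^\alpha}{\mathrm dt^\alpha}f(t)=\frac1{\Gamma(1-\alpha)}\int_0^t(t-s)^{-\alpha}f'(s)\,\mathrm ds$ for $0<\alpha<1$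 (the integral being assumed to converge) and $\frac{\mathrm d^\alpha}{\mathrm dt^\alpha}f(t)=f'(t)$ for $\alpha=1$ is the Caputo derivative. Let $E_{\alpha,1}(x)=\sum_{j\ge0}x^j/\Gamma(j\alpha+1)$. **Notation.** The finite sets $\Theta_n^k\subset\mathbb N_0^n$ ($n,k\ge1$) are defined by $\Theta_1^k=\{(1)\}$ and, for $n\ge2$, $$\Theta_n^k=\begin{cases}\bigcup_{i=1}^k\{(x_1,\dots,x_{n-i},i,0,\dots,0):(x_1,\dots,x_{n-i})\in\Theta_{n-i}^k\},&1\le k\le n-1,\\[2pt] \bigcup_{i=1}^{n-1}\{(x_1,\dots,x_{n-i},i,0,\dots,0):(x_1,\dots,x_{n-i})\in\Theta_{n-i}^n\}\cup\{(n,0,\dots,0)\},&k\ge n,\end{cases}$$ all vectors on the right having length $n$. For $m\ge1$ and a vector $x=(x_1,\dots,x_m)$ of $\Theta_m^k$ put $\Lambda_m=\{0,1,\dots,m\}\setminus\{1\le j\le m-1:x_{j+1}=0\}$ and $m^*=|\Lambda_m|$, let $0=(j)_1<(j)_2<\dots<(j)_{m^*}=m$ be the elements of $\Lambda_m$, and let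 $\mu_l=\sum_{i=1}^k\lambda_{(n_0+(j)_l)_i}$ for $1\le l\le m^*$; all of these depend on $x$. Put $\lambda_{(n)_0}=1$. For $N\ge1$ let $\Omega_N^i=\{(y_1,\dots,y_N)\in\mathbb N_0^N:\sum_{l=1}^Ny_l=i,\ y_l\ge1\text{ for }2\le l\le N\}$. For $m\ge 1$ write $\Theta=\Theta_m^k$ if $1\le k\le m-1$ and $\Theta=\Theta_m^m$ if $k\ge m$. **Theorem.** For every such process and all $t\ge0$, $$p^\alpha(n_0,t)=E_{\alpha,1}\Big(-\sum_{i=1}^k\lambda_{(n_0)_i}t^\alpha\Big),$$ and, for every $m\ge1$, $$p^\alpha(n_0+m,t)=\sum_{x\in\Theta}\ \prod_{j=0}^{m-1}\lambda_{(n_0+j)_{x_{j+1}}}\ \frac{(-1)^{m^*-1}}{\prod_{l=2}^{m^*}\mu_l}\sum_{i=m^*-1}^\infty\frac{(-t^\alpha)^i}{\Gamma(i\alpha+1)}\sum_{y\in\Omega^i_{m^*}}\ \prod_{l=1}^{m^*}\mu_l^{y_l},$$ where the series over $i$ converges for each $x\in\Theta$. If moreover, for every $x\in\Theta$, the numbers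 $\mu_1,\dots,\mu_{m^*}$ are distinct, then $$p^\alpha(n_0+m,t)=\sum_{x\in\Theta}\ \prod_{j=0}^{m-1}\lambda_{(n_0+j)_{x_{j+1}}}\ \sum_{i=1}^{m^*}\frac{E_{\alpha,1}(-\mu_it^\alpha)}{\prod_{l=1,\,l\ne i}^{m^*}(\mu_l-\mu_i)}.$$ -/

import Mathlib

open MeasureTheory
open scoped NNReal

noncomputable section

/-! ### Mittag-Leffler function and Caputo derivative -/

/-- The Mittag-Leffler function `E_{α,β}(x) = ∑_j x^j / Γ(jα + β)`. -/
def mittagLeffler (α β x : ℝ) : ℝ := ∑' j : ℕ, x ^ j / Real.Gamma (j * α + β)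

/-- `HasCaputoDerivAt α f c t`: the Caputo derivative of order `0 < α ≤ 1` of `f` exists at `t`
and equals `c`. For `α < 1` it is `(1 / Γ(1-α)) ∫_0^t (t-s)^{-α} f'(s) ds`, where the integral
is required to converge; for `α = 1` it is `f'(t)`. -/
def HasCaputoDerivAt (α : ℝ) (f : ℝ → ℝ) (c t : ℝ) : Prop :=
  (α < 1 ∧
    IntervalIntegrable (fun s => (t - s) ^ (-α) * deriv f s) volume 0 t ∧
    1 / Real.Gamma (1 - α) * ∫ s in (0 : ℝ)..t, (t - s) ^ (-α) * deriv f s = c) ∨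
  (α = 1 ∧ HasDerivAt f c t)

/-! ### The process -/

/-- The state probability `Pr{X(t) = n}` as a function of real time `t`
(only `t ≥ 0` is meaningful). -/
def stateProb {Ω : Type*} [MeasurableSpace Ω] (P : Measure Ω) (X : ℝ≥0 → Ω → ℕ∞)
    (n : ℕ) (t : ℝ) : ℝ :=
  P.real {ω | X t.toNNReal ω = (n : ℕ∞)}

/-- The generalized fractional birth process of order `α` with `n₀` progenitors, jumps of sizes
`1, …, k` and rate `lam n i` of a jump of size `i` from the state `n`: a process whose state
probabilities solve the Caputo fractional system. The value `⊤` is the cemetery state reached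
after an explosion, so that `∑_n Pr{X(t) = n} < 1` is allowed. Local absolute continuity on
`[0, ∞)` is the standard condition under which `f'` exists almost everywhere, is locally
integrable, and the Caputo derivative together with the initial value `f(0)` determines `f`. -/
structure IsGFBP {Ω : Type*} [MeasurableSpace Ω] (P : Measure Ω) (X : ℝ≥0 → Ω → ℕ∞)
    (α : ℝ) (k n₀ : ℕ) (lam : ℕ → ℕ → ℝ) : Prop where
  measurable : ∀ t, Measurable (X t)
  /-- the states are `n₀, n₀ + 1, …` -/
  state_ge : ∀ t, ∀ᵐ ω ∂P, (n₀ : ℕ∞) ≤ X t ω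
  init_self : stateProb P X n₀ 0 = 1
  init_gt : ∀ n, n₀ < n → stateProb P X n 0 = 0
  absCont : ∀ n, n₀ ≤ n → ∀ T : ℝ, 0 < T →
    AbsolutelyContinuousOnInterval (stateProb P X n) 0 T
  equation : ∀ n, n₀ ≤ n → ∀ t : ℝ, 0 < t →
    HasCaputoDerivAt α (stateProb P X n)
      (-(∑ i ∈ Finset.Icc 1 k, lam n i) * stateProb P X n t
        + ∑ i ∈ Finset.Icc 1 (min n k), lam (n - i) i * stateProb P X (n - i) t) t

/-! ### The combinatorial sets -/

/-- `x Q_{(n-i)×n} + i e_n^{n-i+1}`: pad the vector `x` of length `n - i` with zeros to length `n`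
and add `i` at the (1-based) place `n - i + 1`. -/
def appendJump (n i : ℕ) (x : Fin (n - i) → ℕ) : Fin n → ℕ := fun j =>
  (if h : (j : ℕ) < n - i then x ⟨j, h⟩ else 0) + (if (j : ℕ) = n - i then i else 0)

/-- The sets `Θ_n^k ⊆ ℕ^n` (a vector `(x_1, …, x_n)` is `x : Fin n → ℕ` with `x_{j+1} = x j`);
the index `i : ℕ` in the unions over `Finset.range` stands for the jump size `i + 1`. There is no
`Θ_0^k`; the value at `n = 0` is never used. -/
def Theta : (n k : ℕ) → Finset (Fin n → ℕ)
  | 0, _ => ∅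
  | 1, _ => {fun _ => 1}
  | n + 2, k =>
    if k ≤ n + 1 then
      (Finset.range k).biUnion fun i =>
        (Theta (n + 2 - (i + 1)) k).image (appendJump (n + 2) (i + 1))
    else
      ((Finset.range (n + 1)).biUnion fun i =>
        (Theta (n + 2 - (i + 1)) (n + 2)).image (appendJump (n + 2) (i + 1)))
      ∪ {fun j : Fin (n + 2) => if (j : ℕ) = 0 then n + 2 else 0}
termination_by n _ => n
decreasing_by all_goals omega

/-- `Λ_m = {0, 1, …, m} \ {1 ≤ j ≤ m - 1 : x_{j+1} = 0}`. -/
def Lam {m : ℕ} (x : Fin m → ℕ) : Finset ℕ :=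
  (Finset.range (m + 1)).filter fun j => ¬ (1 ≤ j ∧ ∃ h : j < m, x ⟨j, h⟩ = 0)

/-- `m^* = |Λ_m|`. -/
def mStar {m : ℕ} (x : Fin m → ℕ) : ℕ := (Lam x).card

/-- `(j)_l`, `l = 1, …, m^*`: the elements of `Λ_m` in increasing order, so that the first one is
`0`, each next one is the least `j > (j)_{l-1}` with `x_{j+1} ≠ 0`, and the last one is `m`.
The index `l : Fin m^*` is 0-based. -/
def jIdx {m : ℕ} (x : Fin m → ℕ) (l : Fin (mStar x)) : ℕ := (Lam x).orderEmbOfFin rfl l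

/-- `μ_l = ∑_{i=1}^k λ_{(n₀ + (j)_l)_i}`. -/
def mu (lam : ℕ → ℕ → ℝ) (k n₀ : ℕ) {m : ℕ} (x : Fin m → ℕ) (l : Fin (mStar x)) : ℝ :=
  ∑ i ∈ Finset.Icc 1 k, lam (n₀ + jIdx x l) i

/-- `∏_{j=0}^{m-1} λ_{(n₀+j)_{x_{j+1}}}` with `λ_{(n)_0}` read as `1`. -/
def rateProd (lam : ℕ → ℕ → ℝ) (n₀ : ℕ) {m : ℕ} (x : Fin m → ℕ) : ℝ :=
  ∏ j : Fin m, if x j = 0 then 1 else lam (n₀ + j) (x j)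

/-- `Ω_n^i = {(y_1, …, y_n) ∈ ℕ^n : ∑ y_j = i, y_j ≥ 1 for 2 ≤ j ≤ n}`. -/
def OmegaSet (n i : ℕ) : Finset (Fin n → ℕ) :=
  (Finset.piAntidiag Finset.univ i).filter fun y => ∀ j : Fin n, (j : ℕ) ≠ 0 → 1 ≤ y j

/-! ### The terms of the two formulas -/

/-- `(-t^α)^i / Γ(iα+1) ∑_{y ∈ Ω_N^i} ∏_l μ_l^{y_l}`. -/
def seriesTerm (α t : ℝ) {N : ℕ} (μ : Fin N → ℝ) (i : ℕ) : ℝ :=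
  (-(t ^ α)) ^ i / Real.Gamma (i * α + 1) * ∑ y ∈ OmegaSet N i, ∏ l, μ l ^ y l

/-- `((-1)^{N-1} / ∏_{l=2}^N μ_l) ∑_{i ≥ N-1} (-t^α)^i / Γ(iα+1) ∑_{y ∈ Ω_N^i} ∏_l μ_l^{y_l}`. -/
def seriesForm (α t : ℝ) {N : ℕ} (μ : Fin N → ℝ) : ℝ :=
  (-1) ^ (N - 1) / (∏ l ∈ Finset.univ.filter (fun l : Fin N => (l : ℕ) ≠ 0), μ l)
    * ∑' i : Set.Ici (N - 1), seriesTerm α t μ i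

/-- `∑_{i=1}^N E_{α,1}(-μ_i t^α) / ∏_{l ≠ i} (μ_l - μ_i)`. -/
def distinctForm (α t : ℝ) {N : ℕ} (μ : Fin N → ℝ) : ℝ :=
  ∑ i, mittagLeffler α 1 (-(μ i) * t ^ α) / ∏ l ∈ Finset.univ.erase i, (μ l - μ i)

end

/-!
The argument does not use Laplace transforms. Write `I f` for the Riemann–Liouville integral of
order `α` (`rlIntegral`) and `e_j(t) = t ^ (α j) / Γ(α j + 1)`.

Applying `I` to the Caputo equation of a locally absolutely continuous function gives back the
function minus its initial value (`eq_add_rlIntegral_of_hasCaputoDerivAt`; Fubini, the Beta integral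
and the fundamental theorem of calculus). The state probabilities therefore solve the triangular
system `p_m = δ_{m,0} + I (∑_{l ≤ m} A_{m,l} p_l)`, where states are counted from `n₀`. Since
`I e_j = e_{j+1}`, iterating it `J` times leaves the partial sum `∑_{j < J} c_{m,j} e_j` with
`c_{m,0} = δ_{m,0}` and `c_{m,j+1} = ∑_l A_{m,l} c_{l,j}`, plus a remainder which is
at most `B ^ J e_J` because probabilities are bounded by `1`. The remainder tends to `0` since the
Mittag-Leffler series converges, so `p_m = ∑_j c_{m,j} e_j` (`tendsto_of_rlIntegral_system`): this
step is both existence of the expansion and uniqueness of the solution.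

The rest is algebra. A vector of `Theta m k` records a path from `0` to `m` with jumps of size at
most `k`, and `Lam` is the set of states it visits. Let `pathSeries s ρ` be the power series
`X ^ (|s| - 1) / ∏_{l ∈ s} (1 + ρ_l X)`. Splitting off the last jump of a path inserts one state into
`s`, and shows that `c_{m,j}` is the sum over paths of the product of the jump rates and the
coefficient of `X ^ j` in `pathSeries` (`stateCoeff_succ`). Finally, expanding each factor of
`pathSeries` as a geometric series gives the sums over `OmegaSet`
(`neg_one_pow_mul_sum_OmegaSet`), and, for distinct rates, its partial fraction expansion gives the
sum of Mittag-Leffler functions (`coeff_pathSeries_of_injOn`).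
-/

/-! ### Beta integrals and the Riemann–Liouville integral -/

theorem integral_sub_rpow_mul_rpow {a b t : ℝ} (ha : 0 < a) (hb : 0 < b) (ht : 0 < t) :
    ∫ s in (0 : ℝ)..t, (t - s) ^ (a - 1) * s ^ (b - 1) =
      Real.Gamma a * Real.Gamma b / Real.Gamma (a + b) * t ^ (a + b - 1) := by
  have h := Complex.betaIntegral_scaled (b : ℂ) (a : ℂ) ht
  rw [Complex.betaIntegral_eq_Gamma_mul_div _ _ (by simpa using hb) (by simpa using ha)] at h
  rw [← Complex.ofReal_add, Complex.Gamma_ofReal, Complex.Gamma_ofReal, Complex.Gamma_ofReal] at h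
  have h2 : ∫ x in (0 : ℝ)..t, (x : ℂ) ^ ((b : ℂ) - 1) * ((t : ℂ) - x) ^ ((a : ℂ) - 1) =
      ∫ x in (0 : ℝ)..t, (((t - x) ^ (a - 1) * x ^ (b - 1) : ℝ) : ℂ) := by
    rw [intervalIntegral.integral_of_le ht.le, intervalIntegral.integral_of_le ht.le]
    refine setIntegral_congr_fun measurableSet_Ioc fun x hx => ?_
    simp only [Complex.ofReal_mul]
    rw [Complex.ofReal_cpow (sub_nonneg.2 hx.2), Complex.ofReal_cpow hx.1.le]
    push_cast
    ring
  rw [h2, intervalIntegral.integral_ofReal] at h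
  have h3 : (t : ℂ) ^ (((b + a : ℝ) : ℂ) - 1) = ((t ^ (b + a - 1) : ℝ) : ℂ) := by
    rw [Complex.ofReal_cpow ht.le]; push_cast; rfl
  rw [h3] at h
  have h4 := Complex.ofReal_injective (h.trans (by push_cast; rfl :
    _ = ((t ^ (b + a - 1) * (Real.Gamma b * Real.Gamma a / Real.Gamma (b + a)) : ℝ) : ℂ)))
  rw [h4, add_comm b a]
  ring

theorem intervalIntegrable_sub_rpow_mul_rpow {a b t : ℝ} (ha : 0 < a) (hb : 0 < b) (ht : 0 < t) :
    IntervalIntegrable (fun s => (t - s) ^ (a - 1) * s ^ (b - 1)) volume 0 t := by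
  -- a non-integrable function would have integral zero
  apply intervalIntegral.intervalIntegrable_of_integral_ne_zero
  rw [integral_sub_rpow_mul_rpow ha hb ht]
  have := Real.Gamma_pos_of_pos ha
  have := Real.Gamma_pos_of_pos hb
  have := Real.Gamma_pos_of_pos (add_pos ha hb)
  positivity

/-- The Abel kernels of orders `a` and `1 - a` compose to a constant. -/
theorem integral_abel_kernels {a r t : ℝ} (ha : 0 < a) (ha1 : a < 1) (hrt : r < t) :
    ∫ s in r..t, (t - s) ^ (a - 1) * (s - r) ^ (-a) = Real.Gamma a * Real.Gamma (1 - a) := by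
  have h := integral_sub_rpow_mul_rpow ha (sub_pos.2 ha1) (sub_pos.2 hrt)
  have h2 := intervalIntegral.integral_comp_sub_right
    (fun u => ((t - r) - u) ^ (a - 1) * u ^ ((1 - a) - 1)) r (a := r) (b := t)
  rw [sub_self, h] at h2
  simpa [sub_sub_sub_cancel_right] using h2

theorem intervalIntegrable_sub_rpow {a t : ℝ} (ha : 0 < a) (ht : 0 < t) :
    IntervalIntegrable (fun s => (t - s) ^ (a - 1)) volume 0 t := by
  simpa using intervalIntegrable_sub_rpow_mul_rpow ha one_pos ht

/-- The Riemann–Liouville fractional integral of order `a`, based at `0`. -/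
noncomputable def rlIntegral (a : ℝ) (f : ℝ → ℝ) (t : ℝ) : ℝ :=
  (Real.Gamma a)⁻¹ * ∫ s in (0 : ℝ)..t, (t - s) ^ (a - 1) * f s

theorem intervalIntegrable_rlIntegral {a t : ℝ} (ha : 0 < a) (ht : 0 ≤ t) {f : ℝ → ℝ}
    (hf : ContinuousOn f (Set.Icc 0 t)) :
    IntervalIntegrable (fun s => (t - s) ^ (a - 1) * f s) volume 0 t := by
  rcases ht.eq_or_lt with rfl | ht
  · simp
  · exact (intervalIntegrable_sub_rpow ha ht).mul_continuousOn (by rwa [Set.uIcc_of_le ht.le])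

theorem rlIntegral_pow {a t : ℝ} (ha : 0 < a) (ht : 0 ≤ t) (j : ℕ) :
    rlIntegral a (fun s => (s ^ a) ^ j / Real.Gamma (j * a + 1)) t =
      (t ^ a) ^ (j + 1) / Real.Gamma ((j + 1 : ℕ) * a + 1) := by
  rcases ht.eq_or_lt with rfl | ht
  · simp [rlIntegral, Real.zero_rpow ha.ne']
  have hb : 0 < (j : ℝ) * a + 1 := by positivity
  have h := integral_sub_rpow_mul_rpow ha hb ht
  have hG := Real.Gamma_pos_of_pos hb
  have hG' := Real.Gamma_pos_of_pos ha
  have h1 : ∫ s in (0 : ℝ)..t, (t - s) ^ (a - 1) * ((s ^ a) ^ j / Real.Gamma (j * a + 1)) =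
      (Real.Gamma (j * a + 1))⁻¹ *
        ∫ s in (0 : ℝ)..t, (t - s) ^ (a - 1) * s ^ ((j : ℝ) * a + 1 - 1) := by
    rw [← intervalIntegral.integral_const_mul, intervalIntegral.integral_of_le ht.le,
      intervalIntegral.integral_of_le ht.le]
    refine setIntegral_congr_fun measurableSet_Ioc fun s hs => ?_
    simp only [add_sub_cancel_right]
    rw [mul_comm (j : ℝ) a, Real.rpow_mul hs.1.le, Real.rpow_natCast]
    ring
  rw [rlIntegral, h1, h]
  have e1 : a + (j * a + 1) = ((j + 1 : ℕ) : ℝ) * a + 1 := by push_cast; ring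
  have e2 : t ^ (a + (j * a + 1) - 1) = (t ^ a) ^ (j + 1) := by
    rw [e1, add_sub_cancel_right, mul_comm, Real.rpow_mul ht.le, Real.rpow_natCast]
  rw [e2, e1]
  field_simp

theorem rlIntegral_finsetSum {ι : Type*} {a t : ℝ} (ha : 0 < a) (ht : 0 ≤ t) (s : Finset ι)
    (c : ι → ℝ) (f : ι → ℝ → ℝ) (hf : ∀ i ∈ s, ContinuousOn (f i) (Set.Icc 0 t)) :
    rlIntegral a (fun u => ∑ i ∈ s, c i * f i u) t = ∑ i ∈ s, c i * rlIntegral a (f i) t := by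
  have : (fun u => (t - u) ^ (a - 1) * ∑ i ∈ s, c i * f i u) =
      fun u => ∑ i ∈ s, c i * ((t - u) ^ (a - 1) * f i u) := by
    funext u
    rw [Finset.mul_sum]
    exact Finset.sum_congr rfl fun i _ => by ring
  rw [rlIntegral, this, intervalIntegral.integral_finsetSum
    fun i hi => (intervalIntegrable_rlIntegral ha ht (hf i hi)).const_mul _, Finset.mul_sum]
  refine Finset.sum_congr rfl fun i _ => ?_
  rw [intervalIntegral.integral_const_mul, rlIntegral]
  ring

theorem rlIntegral_sub {a t : ℝ} (ha : 0 < a) (ht : 0 ≤ t) {f g : ℝ → ℝ}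
    (hf : ContinuousOn f (Set.Icc 0 t)) (hg : ContinuousOn g (Set.Icc 0 t)) :
    rlIntegral a (fun s => f s - g s) t = rlIntegral a f t - rlIntegral a g t := by
  simp only [rlIntegral, mul_sub]
  rw [intervalIntegral.integral_sub (intervalIntegrable_rlIntegral ha ht hf)
    (intervalIntegrable_rlIntegral ha ht hg), mul_sub]

theorem rlIntegral_const_mul (a t c : ℝ) (f : ℝ → ℝ) :
    rlIntegral a (fun s => c * f s) t = c * rlIntegral a f t := by
  simp only [rlIntegral, mul_left_comm _ c, intervalIntegral.integral_const_mul]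

theorem abs_rlIntegral_le {a t : ℝ} (ha : 0 < a) (ht : 0 ≤ t) {f g : ℝ → ℝ}
    (hg : ContinuousOn g (Set.Icc 0 t)) (hfg : ∀ s ∈ Set.Icc 0 t, |f s| ≤ g s) :
    |rlIntegral a f t| ≤ rlIntegral a g t := by
  have hG := Real.Gamma_pos_of_pos ha
  rw [rlIntegral, rlIntegral, abs_mul, abs_of_pos (inv_pos.2 hG)]
  refine mul_le_mul_of_nonneg_left ?_ (inv_pos.2 hG).le
  rw [← Real.norm_eq_abs]
  refine intervalIntegral.norm_integral_le_of_norm_le ht ?_ (intervalIntegrable_rlIntegral ha ht hg)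
  refine ae_of_all _ fun s hs => ?_
  have h0 : 0 ≤ (t - s) ^ (a - 1) := Real.rpow_nonneg (sub_nonneg.2 hs.2) _
  rw [norm_mul, Real.norm_of_nonneg h0, Real.norm_eq_abs]
  exact mul_le_mul_of_nonneg_left (hfg s ⟨hs.1.le, hs.2⟩) h0

/-! ### From the Caputo equation to the integral equation -/

/-- Integrating the Abel transform of order `1 - a` against the kernel of order `a` gives back,
up to the factor `Γ(a) Γ(1 - a)`, the ordinary integral (Fubini and the Beta integral). -/
theorem integral_abel_integral_abel {a t : ℝ} (ha : 0 < a) (ha1 : a < 1) (ht : 0 < t) {g : ℝ → ℝ}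
    (hgm : Measurable g) (hg : IntervalIntegrable g volume 0 t) :
    ∫ s in (0 : ℝ)..t, (t - s) ^ (a - 1) * ∫ r in (0 : ℝ)..s, (s - r) ^ (-a) * g r =
      Real.Gamma a * Real.Gamma (1 - a) * ∫ r in (0 : ℝ)..t, g r := by
  set μ : Measure ℝ := volume.restrict (Set.Ioo 0 t) with hμ
  set K : ℝ → ℝ → ℝ := fun s r => if r < s then (t - s) ^ (a - 1) * (s - r) ^ (-a) else 0 with hK
  have hKm : Measurable (fun z : ℝ × ℝ => K z.1 z.2) := by
    refine Measurable.ite (measurableSet_lt measurable_snd measurable_fst) ?_ measurable_const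
    exact ((measurable_const.sub measurable_fst).pow_const _).mul
      ((measurable_fst.sub measurable_snd).pow_const _)
  have hind : ∀ r : ℝ, (fun s => K s r) =
      (Set.Ioi r).indicator fun s => (t - s) ^ (a - 1) * (s - r) ^ (-a) := by
    intro r; funext s; simp [hK, Set.indicator]
  have hset : ∀ r ∈ Set.Ioo (0 : ℝ) t, Set.Ioi r ∩ Set.Ioo 0 t = Set.Ioo r t := by
    intro r hr; ext s; simp only [Set.mem_inter_iff, Set.mem_Ioi, Set.mem_Ioo]
    constructor
    · rintro ⟨h1, h2, h3⟩; exact ⟨h1, h3⟩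
    · rintro ⟨h1, h2⟩; exact ⟨h1, hr.1.trans h1, h2⟩
  have hG := Real.Gamma_pos_of_pos ha
  have hG1 := Real.Gamma_pos_of_pos (sub_pos.2 ha1)
  have hKint : ∀ r ∈ Set.Ioo (0 : ℝ) t, ∫ s, K s r ∂μ = Real.Gamma a * Real.Gamma (1 - a) := by
    intro r hr
    rw [hind r, integral_indicator measurableSet_Ioi, hμ,
      Measure.restrict_restrict measurableSet_Ioi, hset r hr,
      ← integral_Ioc_eq_integral_Ioo, ← intervalIntegral.integral_of_le hr.2.le,
      integral_abel_kernels ha ha1 hr.2]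
  have hKi : ∀ r ∈ Set.Ioo (0 : ℝ) t, Integrable (fun s => K s r) μ := by
    intro r hr
    apply Integrable.of_integral_ne_zero
    rw [hKint r hr]; positivity
  have hKnn : ∀ r, ∀ s ∈ Set.Ioo (0 : ℝ) t, 0 ≤ K s r := by
    intro r s hs
    simp only [hK]
    split_ifs with h
    · exact mul_nonneg (Real.rpow_nonneg (sub_nonneg.2 hs.2.le) _)
        (Real.rpow_nonneg (sub_nonneg.2 h.le) _)
    · exact le_rfl
  have hgi : Integrable g μ := by
    rw [hμ, ← IntegrableOn, ← integrableOn_Ioc_iff_integrableOn_Ioo,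
      ← intervalIntegrable_iff_integrableOn_Ioc_of_le ht.le]
    exact hg
  have hmem : ∀ᵐ r ∂μ, r ∈ Set.Ioo (0 : ℝ) t := ae_restrict_mem measurableSet_Ioo
  have hF : Integrable (Function.uncurry fun s r => K s r * g r) (μ.prod μ) := by
    have hm : Measurable (Function.uncurry fun s r => K s r * g r) :=
      hKm.mul (hgm.comp measurable_snd)
    rw [integrable_prod_iff' hm.aestronglyMeasurable]
    refine ⟨?_, ?_⟩
    · filter_upwards [hmem] with r hr
      exact (hKi r hr).mul_const (g r)
    · refine (hgi.norm.const_mul (Real.Gamma a * Real.Gamma (1 - a))).congr ?_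
      filter_upwards [hmem] with r hr
      have : ∀ᵐ s ∂μ, ‖Function.uncurry (fun s r => K s r * g r) (s, r)‖ = K s r * ‖g r‖ := by
        filter_upwards [hmem] with s hs
        simp only [Function.uncurry, norm_mul]
        rw [Real.norm_of_nonneg (hKnn r s hs)]
      rw [integral_congr_ae this, integral_mul_const, hKint r hr]
  have hswap := integral_integral_swap hF
  have hL : ∫ s in (0 : ℝ)..t, (t - s) ^ (a - 1) * ∫ r in (0 : ℝ)..s, (s - r) ^ (-a) * g r =
      ∫ s, ∫ r, K s r * g r ∂μ ∂μ := by
    rw [intervalIntegral.integral_of_le ht.le, integral_Ioc_eq_integral_Ioo]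
    refine setIntegral_congr_fun measurableSet_Ioo fun s hs => ?_
    have e1 : (fun r => K s r * g r) =
        (Set.Iio s).indicator fun r => (t - s) ^ (a - 1) * ((s - r) ^ (-a) * g r) := by
      funext r
      by_cases h : r < s
      · simp [hK, h, mul_assoc]
      · simp [hK, h]
    have e2 : Set.Iio s ∩ Set.Ioo 0 t = Set.Ioo 0 s := by
      ext r; simp only [Set.mem_inter_iff, Set.mem_Iio, Set.mem_Ioo]
      constructor
      · rintro ⟨h1, h2, h3⟩; exact ⟨h2, h1⟩
      · rintro ⟨h1, h2⟩; exact ⟨h2, h1, h2.trans hs.2⟩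
    rw [e1, integral_indicator measurableSet_Iio, hμ, Measure.restrict_restrict measurableSet_Iio,
      e2, integral_const_mul, intervalIntegral.integral_of_le hs.1.le, integral_Ioc_eq_integral_Ioo]
  have hR : ∫ r, ∫ s, K s r * g r ∂μ ∂μ =
      Real.Gamma a * Real.Gamma (1 - a) * ∫ r in (0 : ℝ)..t, g r := by
    rw [intervalIntegral.integral_of_le ht.le, integral_Ioc_eq_integral_Ioo, ← integral_const_mul]
    refine setIntegral_congr_fun measurableSet_Ioo fun r hr => ?_
    rw [integral_mul_const, hKint r hr]
  rw [hL, hswap, hR]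

/-- A locally absolutely continuous function is its initial value plus the fractional integral of
its Caputo derivative. -/
theorem eq_add_rlIntegral_of_hasCaputoDerivAt {a : ℝ} (ha : 0 < a) {f c : ℝ → ℝ}
    (hf : ∀ T : ℝ, 0 < T → AbsolutelyContinuousOnInterval f 0 T)
    (hc : ∀ t : ℝ, 0 < t → HasCaputoDerivAt a f (c t) t) {t : ℝ} (ht : 0 ≤ t) :
    f t = f 0 + rlIntegral a c t := by
  rcases ht.eq_or_lt with rfl | ht
  · simp [rlIntegral]
  have hFTC := (hf t ht).integral_deriv_eq_sub
  suffices h : rlIntegral a c t = ∫ s in (0 : ℝ)..t, deriv f s by rw [h, hFTC]; ring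
  by_cases ha1 : a < 1
  · have hG := Real.Gamma_pos_of_pos ha
    have hG1 := Real.Gamma_pos_of_pos (sub_pos.2 ha1)
    have h := integral_abel_integral_abel ha ha1 ht (measurable_deriv f)
      (hf t ht).intervalIntegrable_deriv
    have e : ∫ s in (0 : ℝ)..t, (t - s) ^ (a - 1) * c s = (Real.Gamma (1 - a))⁻¹ *
        ∫ s in (0 : ℝ)..t, (t - s) ^ (a - 1) * ∫ r in (0 : ℝ)..s, (s - r) ^ (-a) * deriv f r := by
      rw [← intervalIntegral.integral_const_mul, intervalIntegral.integral_of_le ht.le,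
        intervalIntegral.integral_of_le ht.le]
      refine setIntegral_congr_fun measurableSet_Ioc fun s hs => ?_
      rcases hc s hs.1 with ⟨_, _, h3⟩ | ⟨h1, _⟩
      · simp only [← h3]; ring
      · exact absurd h1 ha1.ne
    rw [rlIntegral, e, h]
    field_simp
  · have hderiv : ∀ s, 0 < s → a = 1 ∧ HasDerivAt f (c s) s := fun s hs =>
      (hc s hs).resolve_left fun h => ha1 h.1
    obtain ⟨rfl, -⟩ := hderiv t ht
    rw [rlIntegral, Real.Gamma_one, inv_one, one_mul, intervalIntegral.integral_of_le ht.le,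
      intervalIntegral.integral_of_le ht.le]
    refine setIntegral_congr_fun measurableSet_Ioc fun s hs => ?_
    simp [(hderiv s hs.1).2.deriv]

/-! ### Mittag-Leffler type series -/

/-- The Mittag-Leffler series converges for every argument: the Gamma function
outgrows every exponential. -/
theorem summable_pow_div_Gamma {a : ℝ} (ha : 0 < a) (x : ℝ) :
    Summable fun j : ℕ => x ^ j / Real.Gamma (j * a + 1) := by
  -- `B` is chosen so that `B ^ a = 2 (|x| + 1)`
  set y : ℝ := 2 * (|x| + 1) with hy
  have hy2 : 2 ≤ y := by have := abs_nonneg x; linarith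
  set B : ℝ := y ^ a⁻¹ with hB
  have hBa : B ^ a = y := by
    rw [hB, ← Real.rpow_mul (by linarith), inv_mul_cancel₀ ha.ne', Real.rpow_one]
  have hB1 : 1 ≤ B := Real.one_le_rpow (by linarith) (inv_nonneg.2 ha.le)
  have hfac : ∀ᶠ n : ℕ in Filter.atTop, B ^ n / n.factorial ≤ 1 :=
    (FloorSemiring.tendsto_pow_div_factorial_atTop B).eventually (ge_mem_nhds one_pos)
  have hfl : Filter.Tendsto (fun j : ℕ => ⌊(j : ℝ) * a⌋₊) Filter.atTop Filter.atTop :=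
    tendsto_nat_floor_atTop.comp (tendsto_natCast_atTop_atTop.atTop_mul_const ha)
  have hmain : ∀ᶠ j : ℕ in Filter.atTop, ‖x ^ j / Real.Gamma (j * a + 1)‖ ≤ B * (1 / 2) ^ j := by
    filter_upwards [hfl.eventually hfac, hfl.eventually (Filter.eventually_ge_atTop 1)] with j h1 h2
    set n := ⌊(j : ℝ) * a⌋₊ with hn
    have hja : 0 ≤ (j : ℝ) * a := by positivity
    have hle : (n : ℝ) ≤ j * a := Nat.floor_le hja
    have hlt : (j : ℝ) * a < n + 1 := Nat.lt_floor_add_one _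
    have hn1 : (1 : ℝ) ≤ n := by exact_mod_cast h2
    have hG : (n.factorial : ℝ) ≤ Real.Gamma (j * a + 1) := by
      rw [← Real.Gamma_nat_eq_factorial]
      exact Real.Gamma_strictMonoOn_Ici.monotoneOn (Set.mem_Ici.2 (by linarith))
        (Set.mem_Ici.2 (by linarith)) (by linarith)
    have hfp : (0 : ℝ) < n.factorial := by exact_mod_cast n.factorial_pos
    have hBn : B ^ n ≤ Real.Gamma (j * a + 1) := by
      rw [div_le_one hfp] at h1; exact h1.trans hG
    have hyB : y ^ j ≤ B * B ^ n := by
      have : y ^ j = B ^ ((j : ℝ) * a) := by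
        rw [mul_comm, Real.rpow_mul (by linarith), hBa, Real.rpow_natCast]
      rw [this, ← pow_succ', ← Real.rpow_natCast]
      exact Real.rpow_le_rpow_of_exponent_le hB1 (by push_cast; exact hlt.le)
    have hGp : 0 < Real.Gamma (j * a + 1) := hfp.trans_le hG
    rw [norm_div, norm_pow, Real.norm_eq_abs, Real.norm_of_nonneg hGp.le, div_le_iff₀ hGp]
    have hxy : |x| ^ j ≤ (1 / 2) ^ j * y ^ j := by
      rw [← mul_pow]
      exact pow_le_pow_left₀ (abs_nonneg x) (by rw [hy]; linarith) j
    calc |x| ^ j ≤ (1 / 2) ^ j * y ^ j := hxy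
      _ ≤ (1 / 2) ^ j * (B * Real.Gamma (j * a + 1)) := by
        refine mul_le_mul_of_nonneg_left (hyB.trans ?_) (by positivity)
        exact mul_le_mul_of_nonneg_left hBn (by linarith)
      _ = _ := by ring
  refine Summable.of_norm_bounded_eventually_nat
    ((summable_geometric_of_lt_one (by norm_num) (by norm_num)).mul_left B) hmain

theorem summable_mul_pow_div_Gamma {a : ℝ} (ha : 0 < a) {c : ℕ → ℝ} {A B : ℝ}
    (hc : ∀ j, |c j| ≤ A * B ^ j) (x : ℝ) :
    Summable fun j : ℕ => c j * (x ^ j / Real.Gamma (j * a + 1)) := by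
  refine Summable.of_norm_bounded
    (((summable_pow_div_Gamma ha (B * |x|)).mul_left A)) fun j => ?_
  have hGp : 0 < Real.Gamma (j * a + 1) := Real.Gamma_pos_of_pos (by positivity)
  rw [norm_mul, norm_div, norm_pow, Real.norm_eq_abs, Real.norm_eq_abs, Real.norm_of_nonneg hGp.le,
    mul_pow]
  calc |c j| * (|x| ^ j / Real.Gamma (j * a + 1)) ≤
      (A * B ^ j) * (|x| ^ j / Real.Gamma (j * a + 1)) :=
        mul_le_mul_of_nonneg_right (hc j) (by positivity)
    _ = _ := by ring

/-! ### Solving a triangular system by iteration -/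

/-- The iterates of a bounded solution of a triangular system of fractional integral equations
converge to the solution: after `J` steps the remainder is at most
`B ^ J * (t ^ a) ^ J / Γ(J a + 1)`, where `B` bounds the row sums of the matrix. -/
theorem tendsto_of_rlIntegral_system {a : ℝ} (ha : 0 < a) {A : ℕ → ℕ → ℝ} {p : ℕ → ℝ → ℝ}
    {c : ℕ → ℕ → ℝ} (hcont : ∀ m t, 0 ≤ t → ContinuousOn (p m) (Set.Icc 0 t))
    (hbd : ∀ m t, |p m t| ≤ 1)
    (hp : ∀ m t, 0 ≤ t →
      p m t = c m 0 + rlIntegral a (fun s => ∑ l ∈ Finset.range (m + 1), A m l * p l s) t)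
    (hc : ∀ m j, c m (j + 1) = ∑ l ∈ Finset.range (m + 1), A m l * c l j)
    (M : ℕ) {t : ℝ} (ht : 0 ≤ t) :
    Filter.Tendsto (fun J => ∑ j ∈ Finset.range J, c M j * ((t ^ a) ^ j / Real.Gamma (j * a + 1)))
      Filter.atTop (nhds (p M t)) := by
  set e : ℕ → ℝ → ℝ := fun j t => (t ^ a) ^ j / Real.Gamma (j * a + 1) with he
  have hecont : ∀ j, Continuous (e j) := fun j =>
    ((Real.continuous_rpow_const ha.le).pow j).div_const _
  have he0 : ∀ j t, 0 ≤ t → 0 ≤ e j t := fun j t ht =>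
    div_nonneg (pow_nonneg (Real.rpow_nonneg ht _) _)
      (Real.Gamma_pos_of_pos (by positivity)).le
  have hIe : ∀ j t, 0 ≤ t → rlIntegral a (e j) t = e (j + 1) t := fun j t ht =>
    rlIntegral_pow ha ht j
  set B : ℝ := ∑ m ∈ Finset.range (M + 1), ∑ l ∈ Finset.range (m + 1), |A m l| with hB
  have hB0 : 0 ≤ B := Finset.sum_nonneg fun _ _ => Finset.sum_nonneg fun _ _ => abs_nonneg _
  have hrow : ∀ m ≤ M, ∑ l ∈ Finset.range (m + 1), |A m l| ≤ B := fun m hm =>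
    Finset.single_le_sum (f := fun m => ∑ l ∈ Finset.range (m + 1), |A m l|)
      (fun _ _ => Finset.sum_nonneg fun _ _ => abs_nonneg _)
      (Finset.mem_range.2 (Nat.lt_succ_of_le hm))
  have hscont : ∀ m J, Continuous fun s => ∑ j ∈ Finset.range J, c m j * e j s := fun m J =>
    continuous_finsetSum _ fun j _ => continuous_const.mul (hecont j)
  have key : ∀ J, ∀ m ≤ M, ∀ t, 0 ≤ t →
      |p m t - ∑ j ∈ Finset.range J, c m j * e j t| ≤ B ^ J * e J t := by
    intro J
    induction J with
    | zero =>
      intro m _ t _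
      simpa [he] using hbd m t
    | succ J ih =>
      intro m hm t ht
      have e1 : ∑ j ∈ Finset.range (J + 1), c m j * e j t = c m 0 +
          ∑ l ∈ Finset.range (m + 1), A m l *
            rlIntegral a (fun s => ∑ j ∈ Finset.range J, c l j * e j s) t := by
        have e0 : e 0 t = 1 := by simp [he]
        rw [Finset.sum_range_succ', e0, mul_one, add_comm]
        congr 1
        have : ∀ l ∈ Finset.range (m + 1), A m l *
            rlIntegral a (fun s => ∑ j ∈ Finset.range J, c l j * e j s) t =
            ∑ j ∈ Finset.range J, A m l * c l j * e (j + 1) t := by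
          intro l _
          rw [rlIntegral_finsetSum ha ht _ _ _ fun j _ => (hecont j).continuousOn, Finset.mul_sum]
          exact Finset.sum_congr rfl fun j _ => by rw [hIe j t ht]; ring
        rw [Finset.sum_congr rfl this, Finset.sum_comm]
        exact Finset.sum_congr rfl fun j _ => by rw [hc, Finset.sum_mul]
      have e2 : p m t - ∑ j ∈ Finset.range (J + 1), c m j * e j t =
          ∑ l ∈ Finset.range (m + 1), A m l *
            rlIntegral a (fun s => p l s - ∑ j ∈ Finset.range J, c l j * e j s) t := by
        rw [e1, hp m t ht, rlIntegral_finsetSum ha ht _ _ _ fun l _ => hcont l t ht,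
          add_sub_add_left_eq_sub, ← Finset.sum_sub_distrib]
        refine Finset.sum_congr rfl fun l _ => ?_
        rw [rlIntegral_sub ha ht (hcont l t ht) (hscont l J).continuousOn]
        ring
      rw [e2]
      calc _ ≤ ∑ l ∈ Finset.range (m + 1), |A m l| * (B ^ J * e (J + 1) t) := by
            refine (Finset.abs_sum_le_sum_abs _ _).trans (Finset.sum_le_sum fun l hl => ?_)
            rw [abs_mul, ← hIe J t ht, ← rlIntegral_const_mul]
            refine mul_le_mul_of_nonneg_left ?_ (abs_nonneg _)
            have hl' := Finset.mem_range.1 hl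
            exact abs_rlIntegral_le ha ht (continuous_const.mul (hecont J)).continuousOn
              fun s hs => ih l (by omega) s hs.1
        _ = (∑ l ∈ Finset.range (m + 1), |A m l|) * (B ^ J * e (J + 1) t) := by
            rw [Finset.sum_mul]
        _ ≤ B * (B ^ J * e (J + 1) t) :=
            mul_le_mul_of_nonneg_right (hrow m hm)
              (mul_nonneg (pow_nonneg hB0 _) (he0 _ _ ht))
        _ = _ := by ring
  have hlim : Filter.Tendsto (fun J => B ^ J * e J t) Filter.atTop (nhds 0) := by
    refine (summable_pow_div_Gamma ha (B * t ^ a)).tendsto_atTop_zero.congr fun J => ?_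
    simp only [he, mul_pow]
    ring
  rw [tendsto_iff_norm_sub_tendsto_zero]
  refine squeeze_zero (fun _ => norm_nonneg _) (fun J => ?_) hlim
  rw [norm_sub_rev]
  exact key J M le_rfl t ht

/-! ### The power series attached to a set of visited states -/

/-- The geometric series `1 / (1 + ν X)`. -/
noncomputable def geomSeries (ν : ℝ) : PowerSeries ℝ := PowerSeries.mk fun i => (-ν) ^ i

theorem geomSeries_mul_one_add (ν : ℝ) :
    geomSeries ν * (1 + PowerSeries.C ν * PowerSeries.X) = 1 := by
  ext n
  rw [mul_add, mul_one, ← mul_assoc, mul_comm (geomSeries ν), mul_assoc]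
  cases n with
  | zero => simp [geomSeries]
  | succ n =>
    simp only [geomSeries, map_add, PowerSeries.coeff_C_mul, PowerSeries.coeff_mk,
      PowerSeries.coeff_succ_mul_X, PowerSeries.coeff_one]
    simp only [pow_succ, Nat.succ_ne_zero, if_false]
    ring

/-- The series `X ^ (N - 1) / ∏_{i ∈ s} (1 + ν_i X)`, where `N = |s|`. With `X` read as `p ^ (-α)` it
is, up to the factor `1 / p`, the Laplace transform of the contribution of a path which visits the
states of `s` and leaves them at the rates `ν`. -/
noncomputable def pathSeries {ι : Type*} (s : Finset ι) (ν : ι → ℝ) : PowerSeries ℝ :=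
  PowerSeries.X ^ (s.card - 1) * ∏ i ∈ s, geomSeries (ν i)

theorem pathSeries_map {ι κ : Type*} (s : Finset ι) (f : ι ↪ κ) (ν : κ → ℝ) :
    pathSeries (s.map f) ν = pathSeries s (ν ∘ f) := by
  simp [pathSeries]

theorem pathSeries_singleton {ι : Type*} (i : ι) (ν : ι → ℝ) :
    pathSeries {i} ν = geomSeries (ν i) := by
  simp [pathSeries]

theorem coeff_pathSeries_of_lt {ι : Type*} (s : Finset ι) (ν : ι → ℝ) {j : ℕ}
    (hj : j < s.card - 1) : PowerSeries.coeff j (pathSeries s ν) = 0 := by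
  rw [pathSeries, PowerSeries.coeff_X_pow_mul', if_neg (by omega)]

section insert

variable {ι : Type*} [DecidableEq ι] {s : Finset ι} {i : ι}

theorem pathSeries_insert_mul (hs : s.Nonempty) (hi : i ∉ s) (ν : ι → ℝ) :
    pathSeries (insert i s) ν * (1 + PowerSeries.C (ν i) * PowerSeries.X) =
      pathSeries s ν * PowerSeries.X := by
  have hc : (insert i s).card - 1 = (s.card - 1) + 1 := by
    rw [Finset.card_insert_of_notMem hi]
    have := hs.card_pos
    omega
  rw [pathSeries, pathSeries, hc, Finset.prod_insert hi]
  linear_combination (PowerSeries.X ^ (s.card - 1 + 1) * ∏ i ∈ s, geomSeries (ν i)) *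
    geomSeries_mul_one_add (ν i)

theorem coeff_zero_pathSeries_insert (hs : s.Nonempty) (hi : i ∉ s) (ν : ι → ℝ) :
    PowerSeries.coeff 0 (pathSeries (insert i s) ν) = 0 := by
  apply coeff_pathSeries_of_lt
  rw [Finset.card_insert_of_notMem hi]
  have := hs.card_pos
  omega

theorem coeff_succ_pathSeries_insert (hs : s.Nonempty) (hi : i ∉ s) (ν : ι → ℝ) (j : ℕ) :
    PowerSeries.coeff (j + 1) (pathSeries (insert i s) ν) =
      -ν i * PowerSeries.coeff j (pathSeries (insert i s) ν) +
        PowerSeries.coeff j (pathSeries s ν) := by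
  have h := congrArg (PowerSeries.coeff (j + 1)) (pathSeries_insert_mul hs hi ν)
  rw [mul_add, mul_one, mul_left_comm, map_add, PowerSeries.coeff_C_mul,
    PowerSeries.coeff_succ_mul_X, PowerSeries.coeff_succ_mul_X] at h
  linarith

end insert

theorem abs_coeff_pathSeries_le {ι : Type*} {s : Finset ι} (hs : s.Nonempty) (ν : ι → ℝ) (j : ℕ) :
    |PowerSeries.coeff j (pathSeries s ν)| ≤ (1 + ∑ i ∈ s, |ν i|) ^ j := by
  classical
  induction hs using Finset.Nonempty.cons_induction generalizing j with
  | singleton a =>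
    rw [pathSeries_singleton, geomSeries, PowerSeries.coeff_mk, abs_pow, abs_neg,
      Finset.sum_singleton]
    exact pow_le_pow_left₀ (abs_nonneg _) (by linarith) j
  | cons a s ha hs ih =>
    rw [Finset.cons_eq_insert, Finset.sum_insert ha]
    have h0 : 0 ≤ ∑ i ∈ s, |ν i| := Finset.sum_nonneg fun _ _ => abs_nonneg _
    have h1 := abs_nonneg (ν a)
    induction j with
    | zero => rw [coeff_zero_pathSeries_insert hs ha]; simp
    | succ j ihj =>
      rw [coeff_succ_pathSeries_insert hs ha]
      set B := 1 + (|ν a| + ∑ i ∈ s, |ν i|) with hB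
      have hB0 : 0 ≤ B ^ j := by positivity
      have h2 : (1 + ∑ i ∈ s, |ν i|) ^ j ≤ B ^ j := pow_le_pow_left₀ (by positivity) (by linarith) j
      calc _ ≤ |ν a| * B ^ j + B ^ j := by
            refine (abs_add_le _ _).trans (add_le_add ?_ ((ih j).trans h2))
            rw [abs_mul, abs_neg]
            exact mul_le_mul_of_nonneg_left ihj h1
        _ = (|ν a| + 1) * B ^ j := by ring
        _ ≤ B * B ^ j := mul_le_mul_of_nonneg_right (by linarith) hB0
        _ = _ := by ring

/-- The partial fraction expansion of `pathSeries`, coefficient by coefficient. -/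
theorem coeff_pathSeries_of_injOn {ι : Type*} [DecidableEq ι] {s : Finset ι} (hs : s.Nonempty)
    {ν : ι → ℝ} (hν : Set.InjOn ν s) (j : ℕ) :
    PowerSeries.coeff j (pathSeries s ν) =
      ∑ i ∈ s, (-ν i) ^ j / ∏ l ∈ s.erase i, (ν l - ν i) := by
  induction hs using Finset.Nonempty.cons_induction generalizing j with
  | singleton a => simp [pathSeries_singleton, geomSeries]
  | cons a s ha hs ih =>
    rw [Finset.cons_eq_insert] at hν ⊢
    have hνs : Set.InjOn ν s := hν.mono (by simp)
    induction j with
    | zero =>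
      rw [coeff_zero_pathSeries_insert hs ha]
      -- the sum is the coefficient of degree `|s|` in the Lagrange interpolation of the constant `1`
      have hcard : 1 < (insert a s).card := by
        rw [Finset.card_insert_of_notMem ha]
        have := hs.card_pos
        omega
      have h := Lagrange.coeff_eq_sum (s := insert a s) (v := fun i => -ν i) (P := 1)
        (fun x hx y hy hxy => hν hx hy (neg_injective hxy))
        (by rw [Polynomial.degree_one]; exact_mod_cast (by omega))
      rw [Polynomial.coeff_one, if_neg (by omega)] at h
      simp only [Polynomial.eval_one, neg_sub_neg] at h
      simpa using h
    | succ j ihj =>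
      rw [coeff_succ_pathSeries_insert hs ha, ihj, ih hνs, Finset.sum_insert ha,
        Finset.sum_insert ha, mul_add, Finset.mul_sum, add_assoc, ← Finset.sum_add_distrib]
      congr 1
      · ring
      · refine Finset.sum_congr rfl fun i hi => ?_
        have hia : i ≠ a := fun h => ha (h ▸ hi)
        have hne : ν a - ν i ≠ 0 := fun h => hia
          (hν (by simp [hi]) (by simp) (sub_eq_zero.1 h).symm)
        have hnot : a ∉ s.erase i := fun h => ha (Finset.mem_of_mem_erase h)
        have hP : ∏ l ∈ s.erase i, (ν l - ν i) ≠ 0 := Finset.prod_ne_zero_iff.2 fun l hl h =>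
          (Finset.ne_of_mem_erase hl) (hνs (Finset.mem_of_mem_erase hl) hi (sub_eq_zero.1 h))
        rw [Finset.erase_insert_of_ne hia.symm, Finset.prod_insert hnot]
        field_simp
        ring

/-- The sums over `OmegaSet` are, up to sign and to the factor `∏_{l ≠ 0} μ_l`, the coefficients of
`pathSeries`: each summand `∏ μ_l ^ y_l` is a choice of one term in each of `N` geometric series. -/
theorem neg_one_pow_mul_sum_OmegaSet {N : ℕ} (hN : 0 < N) (μ : Fin N → ℝ) (i : ℕ) :
    (-1) ^ i * ∑ y ∈ OmegaSet N i, ∏ l, μ l ^ y l =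
      (-1) ^ (N - 1) * (∏ l ∈ Finset.univ.filter (fun l : Fin N => (l : ℕ) ≠ 0), μ l) *
        PowerSeries.coeff i (pathSeries Finset.univ μ) := by
  set f : Fin N → PowerSeries ℝ := fun l =>
    PowerSeries.mk fun y => if (l : ℕ) ≠ 0 → 1 ≤ y then (-μ l) ^ y else 0 with hf
  have hcard : (Finset.univ.filter (fun l : Fin N => (l : ℕ) ≠ 0)).card = N - 1 := by
    have : Finset.univ.filter (fun l : Fin N => (l : ℕ) ≠ 0) = Finset.univ.erase ⟨0, hN⟩ := by
      ext l; simp [Fin.ext_iff]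
    rw [this, Finset.card_erase_of_mem (Finset.mem_univ _), Finset.card_univ, Fintype.card_fin]
  have hfl : ∀ l, f l = (if (l : ℕ) ≠ 0 then PowerSeries.C (-μ l) * PowerSeries.X else 1) *
      geomSeries (μ l) := by
    intro l
    by_cases hl : (l : ℕ) = 0
    · simp [hf, hl, geomSeries]
    · ext y
      rw [if_pos hl, mul_assoc, PowerSeries.coeff_C_mul, mul_comm PowerSeries.X]
      cases y with
      | zero => simp [hf, hl]
      | succ y =>
        rw [PowerSeries.coeff_succ_mul_X]
        simp [hf, geomSeries, pow_succ']
  have hprod : ∏ l, f l =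
      PowerSeries.C ((-1) ^ (N - 1) *
        ∏ l ∈ Finset.univ.filter (fun l : Fin N => (l : ℕ) ≠ 0), μ l) *
        pathSeries Finset.univ μ := by
    simp_rw [hfl]
    rw [Finset.prod_mul_distrib, ← Finset.prod_filter, Finset.prod_mul_distrib,
      Finset.prod_const, hcard, ← map_prod, Finset.prod_neg, hcard, pathSeries, Finset.card_univ,
      Fintype.card_fin, mul_assoc]
  have hcoeff := congrArg (PowerSeries.coeff i) hprod
  rw [PowerSeries.coeff_C_mul, PowerSeries.coeff_prod] at hcoeff
  rw [← hcoeff, Finset.mul_sum, OmegaSet, Finset.sum_filter]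
  refine Finset.sum_bij' (fun y _ => Finsupp.equivFunOnFinite.symm y) (fun l _ => ⇑l) ?_ ?_ ?_ ?_ ?_
  · intro y hy
    rw [Finset.mem_piAntidiag] at hy
    rw [Finset.mem_finsuppAntidiag]
    exact ⟨by simpa using hy.1, Finset.subset_univ _⟩
  · intro l hl
    rw [Finset.mem_finsuppAntidiag] at hl
    rw [Finset.mem_piAntidiag]
    exact ⟨hl.1, fun _ _ => Finset.mem_univ _⟩
  · intro y _; rfl
  · intro l _; ext; rfl
  · intro y hy
    rw [Finset.mem_piAntidiag] at hy
    simp only [hf, PowerSeries.coeff_mk, Finsupp.equivFunOnFinite_symm_apply_apply]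
    rw [Finset.prod_ite_zero]
    simp only [Finset.mem_univ, true_imp_iff]
    refine if_congr Iff.rfl ?_ rfl
    have : ∀ l, (-μ l) ^ y l = (-1) ^ y l * μ l ^ y l := fun l => neg_pow _ _
    simp_rw [this]
    rw [Finset.prod_mul_distrib, Finset.prod_pow_eq_pow_sum, hy.1]

/-! ### The two closed forms -/

section forms

variable {α : ℝ} {N : ℕ} {μ : Fin N → ℝ}

theorem seriesTerm_eq (hN : 0 < N) (t : ℝ) (i : ℕ) :
    seriesTerm α t μ i =
      (-1) ^ (N - 1) * (∏ l ∈ Finset.univ.filter (fun l : Fin N => (l : ℕ) ≠ 0), μ l) *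
        (PowerSeries.coeff i (pathSeries Finset.univ μ) *
          ((t ^ α) ^ i / Real.Gamma (i * α + 1))) := by
  rw [seriesTerm, neg_pow (t ^ α)]
  linear_combination ((t ^ α) ^ i / Real.Gamma (i * α + 1)) * neg_one_pow_mul_sum_OmegaSet hN μ i

theorem summable_coeff_pathSeries {ι : Type*} {s : Finset ι} (hs : s.Nonempty) (ν : ι → ℝ)
    (hα : 0 < α) (x : ℝ) :
    Summable fun i : ℕ => PowerSeries.coeff i (pathSeries s ν) *
      (x ^ i / Real.Gamma (i * α + 1)) :=
  summable_mul_pow_div_Gamma (A := 1) hα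
    (fun j => by rw [one_mul]; exact abs_coeff_pathSeries_le hs ν j) x

theorem summable_seriesTerm (hα : 0 < α) (hN : 0 < N) (t : ℝ) (μ : Fin N → ℝ) :
    Summable fun i : ℕ => seriesTerm α t μ i := by
  have : Nonempty (Fin N) := ⟨⟨0, hN⟩⟩
  simp_rw [seriesTerm_eq hN]
  exact (summable_coeff_pathSeries Finset.univ_nonempty μ hα _).mul_left _

theorem seriesForm_eq_tsum (hN : 0 < N) (hμ : ∀ l, μ l ≠ 0) (t : ℝ) :
    seriesForm α t μ = ∑' i : ℕ, PowerSeries.coeff i (pathSeries Finset.univ μ) *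
      ((t ^ α) ^ i / Real.Gamma (i * α + 1)) := by
  have hP : ∏ l ∈ Finset.univ.filter (fun l : Fin N => (l : ℕ) ≠ 0), μ l ≠ 0 :=
    Finset.prod_ne_zero_iff.2 fun l _ => hμ l
  have hs : Function.support (fun i => seriesTerm α t μ i) ⊆ Set.Ici (N - 1) := by
    intro i hi
    by_contra h
    rw [Set.mem_Ici, not_le] at h
    refine hi ?_
    simp only [seriesTerm_eq hN]
    rw [coeff_pathSeries_of_lt _ _ (by simpa using h), zero_mul, mul_zero]
  rw [seriesForm, tsum_subtype_eq_of_support_subset hs]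
  simp_rw [seriesTerm_eq hN]
  rw [tsum_mul_left, ← mul_assoc]
  have h1 : ((-1 : ℝ) ^ (N - 1)) * (-1) ^ (N - 1) = 1 := by rw [← mul_pow]; norm_num
  rw [show (-1 : ℝ) ^ (N - 1) / (∏ l ∈ Finset.univ.filter (fun l : Fin N => (l : ℕ) ≠ 0), μ l) *
      ((-1) ^ (N - 1) * ∏ l ∈ Finset.univ.filter (fun l : Fin N => (l : ℕ) ≠ 0), μ l) = 1 by
    rw [div_mul_eq_mul_div, ← mul_assoc, h1, one_mul, div_self hP], one_mul]

theorem distinctForm_eq_tsum (hα : 0 < α) (hN : 0 < N) (hμ : Function.Injective μ) (t : ℝ) :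
    distinctForm α t μ = ∑' i : ℕ, PowerSeries.coeff i (pathSeries Finset.univ μ) *
      ((t ^ α) ^ i / Real.Gamma (i * α + 1)) := by
  have : Nonempty (Fin N) := ⟨⟨0, hN⟩⟩
  simp_rw [coeff_pathSeries_of_injOn Finset.univ_nonempty hμ.injOn, Finset.sum_mul]
  have e : ∀ (i : Fin N) (j : ℕ), (-μ i) ^ j / (∏ l ∈ Finset.univ.erase i, (μ l - μ i)) *
      ((t ^ α) ^ j / Real.Gamma (j * α + 1)) =
      (-μ i * t ^ α) ^ j / Real.Gamma (j * α + 1) / ∏ l ∈ Finset.univ.erase i, (μ l - μ i) := by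
    intro i j
    rw [mul_pow]
    ring
  simp_rw [e]
  rw [Summable.tsum_finsetSum fun i _ => (summable_pow_div_Gamma hα _).div_const _]
  exact Finset.sum_congr rfl fun i _ => by rw [tsum_div_const, mittagLeffler]

end forms

/-! ### The sets `Theta` and their decomposition by the last jump -/

theorem Theta_congr_of_le {m k k' : ℕ} (hk : m ≤ k) (hk' : m ≤ k') : Theta m k = Theta m k' := by
  match m with
  | 0 => rw [Theta, Theta]
  | 1 => rw [Theta, Theta]
  | n + 2 => rw [Theta, Theta, if_neg (by omega), if_neg (by omega)]

/-- The vector `(m, 0, …, 0)` of a path which reaches `m` in a single jump. -/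
def singleJump (m : ℕ) : Fin m → ℕ := fun j => if (j : ℕ) = 0 then m else 0

theorem appendJump_apply_of_lt {n i : ℕ} (x : Fin (n - i) → ℕ) {j : ℕ} (hj : j < n - i)
    (hn : j < n) : appendJump n i x ⟨j, hn⟩ = x ⟨j, hj⟩ := by
  simp only [appendJump]
  rw [dif_pos hj, if_neg (by omega), add_zero]

theorem appendJump_apply_self {n i : ℕ} (x : Fin (n - i) → ℕ) (hn : n - i < n) :
    appendJump n i x ⟨n - i, hn⟩ = i := by
  simp [appendJump]

theorem appendJump_apply_of_gt {n i : ℕ} (x : Fin (n - i) → ℕ) {j : ℕ} (hj : n - i < j)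
    (hn : j < n) : appendJump n i x ⟨j, hn⟩ = 0 := by
  simp only [appendJump]
  rw [dif_neg (by omega), if_neg (by omega)]

theorem appendJump_injective (n i : ℕ) : Function.Injective (appendJump n i) := by
  intro x y h
  funext j
  have hj : (j : ℕ) < n := by omega
  have := congrFun h ⟨j, hj⟩
  rwa [appendJump_apply_of_lt x j.2, appendJump_apply_of_lt y j.2] at this

theorem appendJump_ne_of_lt {n i i' : ℕ} (h0 : 0 < i) (hi : i < i') (hn : i' ≤ n)
    (x : Fin (n - i) → ℕ) (y : Fin (n - i') → ℕ) : appendJump n i x ≠ appendJump n i' y := by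
  intro h
  have := congrFun h ⟨n - i, by omega⟩
  rw [appendJump_apply_self, appendJump_apply_of_gt y (by omega)] at this
  omega

theorem appendJump_ne_singleJump {n i : ℕ} (h0 : 0 < i) (hn : i < n) (x : Fin (n - i) → ℕ) :
    appendJump n i x ≠ singleJump n := by
  intro h
  have := congrFun h ⟨n - i, by omega⟩
  rw [appendJump_apply_self] at this
  simp only [singleJump] at this
  rw [if_neg (by omega)] at this
  omega

theorem sum_biUnion_appendJump {n r : ℕ} (hr : r < n) (T : ∀ l : ℕ, Finset (Fin l → ℕ))
    (F : (Fin n → ℕ) → ℝ) :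
    ∑ x ∈ (Finset.range r).biUnion
        fun i => (T (n - (i + 1))).image (appendJump n (i + 1)), F x =
      ∑ i ∈ Finset.range r, ∑ x ∈ T (n - (i + 1)), F (appendJump n (i + 1) x) := by
  rw [Finset.sum_biUnion]
  · exact Finset.sum_congr rfl fun i _ => Finset.sum_image (appendJump_injective _ _).injOn
  · intro i hi i' hi' hne
    have hi := Finset.mem_range.1 (Finset.mem_coe.1 hi)
    have hi' := Finset.mem_range.1 (Finset.mem_coe.1 hi')
    simp only [Function.onFun]
    rw [Finset.disjoint_left]
    intro z hz hz'
    obtain ⟨x, -, hx⟩ := Finset.mem_image.1 hz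
    obtain ⟨y, -, hy⟩ := Finset.mem_image.1 hz'
    rcases lt_or_gt_of_ne hne with h | h
    · exact appendJump_ne_of_lt (by omega) (by omega) (by omega) x y (hx.trans hy.symm)
    · exact appendJump_ne_of_lt (by omega) (by omega) (by omega) y x (hy.trans hx.symm)

/-- A path to `m` is a path to `m - (i + 1)` followed by a jump of size `i + 1`, or a single jump; the
decomposition is the same in both branches of the recursive definition of `Theta`. -/
theorem sum_Theta {m k : ℕ} (hm : 1 ≤ m) (hk : 1 ≤ k) (F : (Fin m → ℕ) → ℝ) :
    ∑ x ∈ Theta m k, F x =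
      (∑ i ∈ Finset.range (min k (m - 1)),
        ∑ x ∈ Theta (m - (i + 1)) k, F (appendJump m (i + 1) x)) +
      if m ≤ k then F (singleJump m) else 0 := by
  match m with
  | 0 => omega
  | 1 =>
    have : (fun _ => 1 : Fin 1 → ℕ) = singleJump 1 := by
      funext j; simp [singleJump]
    rw [Theta, Finset.sum_singleton, this, if_pos hk]
    simp
  | n + 2 =>
    rw [Theta]
    by_cases h : k ≤ n + 1
    · rw [if_pos h, if_neg (by omega), add_zero, min_eq_left (by omega),
        sum_biUnion_appendJump (by omega) fun l => Theta l k]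
    · have hT : ∀ i ∈ Finset.range (n + 1),
          (Theta (n + 2 - (i + 1)) (n + 2)).image (appendJump (n + 2) (i + 1)) =
          (Theta (n + 2 - (i + 1)) k).image (appendJump (n + 2) (i + 1)) := fun i _ => by
        rw [Theta_congr_of_le (k := n + 2) (k' := k) (by omega) (by omega)]
      rw [if_neg h, if_pos (by omega), min_eq_right (by omega), Finset.biUnion_congr rfl hT,
        Finset.sum_union, sum_biUnion_appendJump (by omega) fun l => Theta l k,
        Finset.sum_singleton]
      · rfl
      · rw [Finset.disjoint_singleton_right, Finset.mem_biUnion]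
        rintro ⟨i, hi, hz⟩
        obtain ⟨x, -, hx⟩ := Finset.mem_image.1 hz
        have := Finset.mem_range.1 hi
        exact appendJump_ne_singleJump (by omega) (by omega) x hx

/-! ### Visited states and products of rates along a path -/

theorem mem_Lam {m : ℕ} {x : Fin m → ℕ} {j : ℕ} :
    j ∈ Lam x ↔ j ≤ m ∧ ¬ (1 ≤ j ∧ ∃ h : j < m, x ⟨j, h⟩ = 0) := by
  rw [Lam, Finset.mem_filter, Finset.mem_range, Nat.lt_succ_iff]

theorem zero_mem_Lam {m : ℕ} (x : Fin m → ℕ) : 0 ∈ Lam x := by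
  rw [mem_Lam]; simp

theorem mStar_pos {m : ℕ} (x : Fin m → ℕ) : 0 < mStar x := Finset.card_pos.2 ⟨0, zero_mem_Lam x⟩

theorem notMem_Lam_of_lt {m j : ℕ} (x : Fin m → ℕ) (h : m < j) : j ∉ Lam x := fun hj => by
  have := (mem_Lam.1 hj).1
  omega

theorem Lam_appendJump {m i : ℕ} (hi : 1 ≤ i) (him : i < m) (x : Fin (m - i) → ℕ) :
    Lam (appendJump m i x) = insert m (Lam x) := by
  ext j
  rw [Finset.mem_insert, mem_Lam, mem_Lam]
  rcases lt_trichotomy j (m - i) with h | rfl | h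
  · have hj : j < m := by omega
    simp only [appendJump_apply_of_lt x h hj, hj, h, exists_true_left]
    constructor
    · rintro ⟨_, h2⟩; exact Or.inr ⟨by omega, h2⟩
    · rintro (h1 | ⟨_, h2⟩)
      · omega
      · exact ⟨by omega, h2⟩
  · have hj : m - i < m := by omega
    refine iff_of_true ⟨by omega, ?_⟩ (Or.inr ⟨le_rfl, ?_⟩)
    · rintro ⟨_, _, h2⟩
      rw [appendJump_apply_self] at h2
      omega
    · rintro ⟨_, h2, _⟩; omega
  · constructor
    · rintro ⟨h1, h2⟩
      refine Or.inl (h1.eq_or_lt.resolve_right fun hj => h2 ⟨by omega, hj, ?_⟩)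
      exact appendJump_apply_of_gt x h hj
    · rintro (rfl | ⟨h1, _⟩)
      · exact ⟨le_rfl, by rintro ⟨_, h2, _⟩; omega⟩
      · omega

theorem Lam_singleJump (m : ℕ) : Lam (singleJump m) = insert m {0} := by
  ext j
  rw [mem_Lam, Finset.mem_insert, Finset.mem_singleton]
  constructor
  · rintro ⟨h1, h2⟩
    by_contra h
    push Not at h
    exact h2 ⟨by omega, by omega, by simp [singleJump, h.2]⟩
  · rintro (rfl | rfl)
    · exact ⟨le_rfl, by rintro ⟨_, h2, _⟩; omega⟩
    · simp

theorem rateProd_appendJump (lam : ℕ → ℕ → ℝ) (n₀ : ℕ) {m i : ℕ} (hi : 1 ≤ i) (him : i < m)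
    (x : Fin (m - i) → ℕ) :
    rateProd lam n₀ (appendJump m i x) = lam (n₀ + (m - i)) i * rateProd lam n₀ x := by
  set g : ℕ → ℝ := fun j => if hj : j < m then
    if appendJump m i x ⟨j, hj⟩ = 0 then 1 else lam (n₀ + j) (appendJump m i x ⟨j, hj⟩)
    else 1 with hg
  have e1 : rateProd lam n₀ (appendJump m i x) = ∏ j ∈ Finset.range m, g j := by
    rw [rateProd, Finset.prod_range]
    exact Finset.prod_congr rfl fun j _ => by simp [hg]
  have e2 : rateProd lam n₀ x = ∏ j ∈ Finset.range (m - i), g j := by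
    rw [rateProd, Finset.prod_range]
    refine Finset.prod_congr rfl fun j _ => ?_
    have hj : (j : ℕ) < m := by omega
    simp only [hg, hj, dif_pos, appendJump_apply_of_lt x j.2 hj, Fin.eta]
  have e3 : g (m - i) = lam (n₀ + (m - i)) i := by
    have hj : m - i < m := by omega
    have : i ≠ 0 := by omega
    simp only [hg, hj, dif_pos, appendJump_apply_self x hj, if_neg this]
  have e4 : ∏ j ∈ Finset.Ico (m - i + 1) m, g j = 1 := by
    refine Finset.prod_eq_one fun j hj => ?_
    obtain ⟨h1, h2⟩ := Finset.mem_Ico.1 hj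
    simp only [hg, h2, dif_pos, appendJump_apply_of_gt x (by omega) h2, if_true]
  rw [e1, e2, ← Finset.prod_range_mul_prod_Ico g (by omega : m - i + 1 ≤ m),
    Finset.prod_range_succ, e3, e4, mul_one, mul_comm]

theorem rateProd_singleJump (lam : ℕ → ℕ → ℝ) (n₀ : ℕ) {m : ℕ} (hm : 1 ≤ m) :
    rateProd lam n₀ (singleJump m) = lam n₀ m := by
  rw [rateProd, Finset.prod_eq_single (⟨0, hm⟩ : Fin m)]
  · have : m ≠ 0 := by omega
    simp [singleJump, this]
  · intro j _ hj
    have : (j : ℕ) ≠ 0 := fun h => hj (Fin.ext h)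
    simp [singleJump, this]
  · simp

/-! ### The coefficients of the state probabilities -/

/-- The coefficient of `(t ^ α) ^ j / Γ(j α + 1)` in the state probability of `n₀ + m`: a sum over
the paths from `n₀` to `n₀ + m`. Here `ρ l` is the total rate of jumps from `n₀ + l`; the value at
`m = 0`, where there is only the trivial path, is separate because `Theta 0 k` is empty. -/
noncomputable def stateCoeff (lam : ℕ → ℕ → ℝ) (n₀ k : ℕ) (ρ : ℕ → ℝ) (m j : ℕ) : ℝ :=
  if m = 0 then (-ρ 0) ^ j
  else ∑ x ∈ Theta m k, rateProd lam n₀ x * PowerSeries.coeff j (pathSeries (Lam x) ρ)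

/-- The matrix of the birth system, with states counted from `n₀`. -/
def rateMatrix (lam : ℕ → ℕ → ℝ) (n₀ k : ℕ) (ρ : ℕ → ℝ) (m l : ℕ) : ℝ :=
  if l = m then -ρ m else if m - l ≤ k then lam (n₀ + l) (m - l) else 0

/-- A row of the birth system, summed over the states from which `m` is reached or over the sizes
of the last jump. -/
theorem sum_rateMatrix (lam : ℕ → ℕ → ℝ) (n₀ k : ℕ) (ρ : ℕ → ℝ) (m : ℕ) (f : ℕ → ℝ) :
    ∑ l ∈ Finset.range (m + 1), rateMatrix lam n₀ k ρ m l * f l =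
      -ρ m * f m + ∑ i ∈ Finset.range (min k m),
        lam (n₀ + (m - (i + 1))) (i + 1) * f (m - (i + 1)) := by
  rw [Finset.sum_range_succ, add_comm]
  congr 1
  · simp [rateMatrix]
  · rw [← Finset.sum_range_reflect]
    have hsub : Finset.range (min k m) ⊆ Finset.range m := by
      intro i hi
      rw [Finset.mem_range] at hi ⊢
      omega
    symm
    refine Finset.sum_subset_zero_on_sdiff hsub (fun i hi => ?_) (fun i hi => ?_)
    · rw [Finset.mem_sdiff, Finset.mem_range, Finset.mem_range] at hi
      rw [rateMatrix, if_neg (by omega), if_neg (by omega), zero_mul]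
    · rw [Finset.mem_range] at hi
      have e1 : m - 1 - i = m - (i + 1) := by omega
      have e2 : m - (m - (i + 1)) = i + 1 := by omega
      rw [rateMatrix, if_neg (by omega), if_pos (by omega), e1, e2]

theorem sum_rateProd_mul {m k : ℕ} (hm : 1 ≤ m) (hk : 1 ≤ k) (lam : ℕ → ℕ → ℝ) (n₀ : ℕ)
    (G : Finset ℕ → ℝ) :
    ∑ x ∈ Theta m k, rateProd lam n₀ x * G (Lam x) =
      (∑ i ∈ Finset.range (min k (m - 1)), lam (n₀ + (m - (i + 1))) (i + 1) *
        ∑ x ∈ Theta (m - (i + 1)) k, rateProd lam n₀ x * G (insert m (Lam x))) +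
      if m ≤ k then lam n₀ m * G (insert m {0}) else 0 := by
  rw [sum_Theta hm hk, Lam_singleJump, rateProd_singleJump _ _ hm]
  congr 1
  refine Finset.sum_congr rfl fun i hi => ?_
  rw [Finset.mem_range] at hi
  rw [Finset.mul_sum]
  refine Finset.sum_congr rfl fun x _ => ?_
  rw [Lam_appendJump (by omega) (by omega), rateProd_appendJump _ _ (by omega) (by omega), mul_assoc]

theorem stateCoeff_zero {lam : ℕ → ℕ → ℝ} {n₀ k : ℕ} {ρ : ℕ → ℝ} {m : ℕ} (hk : 1 ≤ k) :
    stateCoeff lam n₀ k ρ m 0 = if m = 0 then 1 else 0 := by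
  rw [stateCoeff]
  split_ifs with h
  · simp
  · have hm : 1 ≤ m := by omega
    rw [sum_rateProd_mul hm hk lam n₀ fun S => PowerSeries.coeff 0 (pathSeries S ρ),
      coeff_zero_pathSeries_insert (Finset.singleton_nonempty _) (by simpa using h), mul_zero,
      ite_self, add_zero]
    refine Finset.sum_eq_zero fun i hi => ?_
    rw [Finset.mem_range] at hi
    rw [Finset.sum_eq_zero, mul_zero]
    intro x _
    rw [coeff_zero_pathSeries_insert ⟨0, zero_mem_Lam x⟩ (notMem_Lam_of_lt x (by omega)), mul_zero]

/-- The path sums satisfy the recursion of the birth system: split off the last jump of the path. -/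
theorem stateCoeff_succ {lam : ℕ → ℕ → ℝ} {n₀ k : ℕ} {ρ : ℕ → ℝ} {m : ℕ} (hk : 1 ≤ k) (j : ℕ) :
    stateCoeff lam n₀ k ρ m (j + 1) =
      ∑ l ∈ Finset.range (m + 1), rateMatrix lam n₀ k ρ m l * stateCoeff lam n₀ k ρ l j := by
  rw [sum_rateMatrix]
  by_cases h : m = 0
  · subst h
    simp [stateCoeff, pow_succ']
  have hm : 1 ≤ m := by omega
  have hnot : m ∉ ({0} : Finset ℕ) := by simpa using h
  have hc : ∀ i, stateCoeff lam n₀ k ρ m i = _ := fun i =>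
    (if_neg h).trans (sum_rateProd_mul hm hk lam n₀ fun S => PowerSeries.coeff i (pathSeries S ρ))
  have hlast : ∑ i ∈ Finset.range (min k m),
      lam (n₀ + (m - (i + 1))) (i + 1) * stateCoeff lam n₀ k ρ (m - (i + 1)) j =
      (∑ i ∈ Finset.range (min k (m - 1)),
        lam (n₀ + (m - (i + 1))) (i + 1) * stateCoeff lam n₀ k ρ (m - (i + 1)) j) +
      if m ≤ k then lam n₀ m * (-ρ 0) ^ j else 0 := by
    split_ifs with hmk
    · rw [min_eq_right hmk, min_eq_right (by omega)]
      obtain ⟨n, rfl⟩ : ∃ n, m = n + 1 := ⟨m - 1, by omega⟩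
      rw [Finset.sum_range_succ]
      simp [stateCoeff]
    · rw [add_zero, min_eq_left (by omega), min_eq_left (by omega)]
  have hsingle : PowerSeries.coeff j (pathSeries {0} ρ) = (-ρ 0) ^ j := by
    rw [pathSeries_singleton, geomSeries, PowerSeries.coeff_mk]
  rw [hlast, hc, hc, coeff_succ_pathSeries_insert (Finset.singleton_nonempty _) hnot, hsingle]
  have hsum : ∀ i ∈ Finset.range (min k (m - 1)),
      lam (n₀ + (m - (i + 1))) (i + 1) * ∑ x ∈ Theta (m - (i + 1)) k,
        rateProd lam n₀ x * PowerSeries.coeff (j + 1) (pathSeries (insert m (Lam x)) ρ) =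
      -ρ m * (lam (n₀ + (m - (i + 1))) (i + 1) * ∑ x ∈ Theta (m - (i + 1)) k,
        rateProd lam n₀ x * PowerSeries.coeff j (pathSeries (insert m (Lam x)) ρ)) +
      lam (n₀ + (m - (i + 1))) (i + 1) * stateCoeff lam n₀ k ρ (m - (i + 1)) j := by
    intro i hi
    rw [Finset.mem_range] at hi
    rw [stateCoeff, if_neg (by omega), mul_left_comm, ← mul_add,
      Finset.mul_sum _ _ (-ρ m), ← Finset.sum_add_distrib]
    congr 1
    refine Finset.sum_congr rfl fun x _ => ?_
    rw [coeff_succ_pathSeries_insert ⟨0, zero_mem_Lam x⟩ (notMem_Lam_of_lt x (by omega))]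
    ring
  rw [Finset.sum_congr rfl hsum, Finset.sum_add_distrib, ← Finset.mul_sum]
  split_ifs <;> ring

/-! ### The rates at the visited states -/

theorem pathSeries_mu (lam : ℕ → ℕ → ℝ) (k n₀ : ℕ) {m : ℕ} (x : Fin m → ℕ) :
    pathSeries Finset.univ (mu lam k n₀ x) =
      pathSeries (Lam x) fun l => ∑ i ∈ Finset.Icc 1 k, lam (n₀ + l) i := by
  have h := pathSeries_map Finset.univ ((Lam x).orderEmbOfFin rfl).toEmbedding
    fun l => ∑ i ∈ Finset.Icc 1 k, lam (n₀ + l) i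
  rw [Finset.map_orderEmbOfFin_univ] at h
  exact h.symm

/-! ### The state probabilities -/

namespace IsGFBP

variable {Ω : Type*} [MeasurableSpace Ω] {P : Measure Ω} {X : ℝ≥0 → Ω → ℕ∞} {α : ℝ} {k n₀ : ℕ}
  {lam : ℕ → ℕ → ℝ}

theorem stateProb_eq_zero (hX : IsGFBP P X α k n₀ lam) {n : ℕ} (hn : n < n₀) (t : ℝ) :
    stateProb P X n t = 0 := by
  have h : P {ω | X t.toNNReal ω = (n : ℕ∞)} = 0 := by
    refine measure_mono_null (fun ω hω => ?_) (ae_iff.1 (hX.state_ge t.toNNReal))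
    simp only [Set.mem_ofPred_eq] at hω ⊢
    rw [hω, not_le]
    exact_mod_cast hn
  rw [stateProb, measureReal_def, h, ENNReal.toReal_zero]

/-- The integral form of the birth system, with states counted from `n₀`. -/
theorem stateProb_eq_add_rlIntegral (hX : IsGFBP P X α k n₀ lam) (hα : 0 < α) (m : ℕ) {t : ℝ}
    (ht : 0 ≤ t) :
    stateProb P X (n₀ + m) t = (if m = 0 then 1 else 0) +
      rlIntegral α (fun s => ∑ l ∈ Finset.range (m + 1),
        rateMatrix lam n₀ k (fun l => ∑ i ∈ Finset.Icc 1 k, lam (n₀ + l) i) m l *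
          stateProb P X (n₀ + l) s) t := by
  have hinit : stateProb P X (n₀ + m) 0 = if m = 0 then 1 else 0 := by
    split_ifs with h
    · rw [h, add_zero, hX.init_self]
    · exact hX.init_gt _ (by omega)
  rw [← hinit]
  refine eq_add_rlIntegral_of_hasCaputoDerivAt hα (hX.absCont _ (Nat.le_add_right _ _))
    (fun s hs => ?_) ht
  convert hX.equation (n₀ + m) (Nat.le_add_right _ _) s hs using 1
  rw [sum_rateMatrix]
  congr 1
  have hreindex : ∑ i ∈ Finset.Icc 1 (min (n₀ + m) k),
      lam (n₀ + m - i) i * stateProb P X (n₀ + m - i) s =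
      ∑ i ∈ Finset.range (min (n₀ + m) k),
        lam (n₀ + m - (i + 1)) (i + 1) * stateProb P X (n₀ + m - (i + 1)) s := by
    rw [← Finset.Ico_succ_right_eq_Icc, Finset.sum_Ico_eq_sum_range]
    simp [add_comm 1]
  rw [hreindex]
  -- the terms with a jump from a state below `n₀` vanish
  have hsub : Finset.range (min k m) ⊆ Finset.range (min (n₀ + m) k) := by
    intro i hi
    rw [Finset.mem_range] at hi ⊢
    omega
  refine Finset.sum_subset_zero_on_sdiff hsub (fun i hi => ?_) (fun i hi => ?_)
  · rw [Finset.mem_sdiff, Finset.mem_range, Finset.mem_range] at hi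
    rw [hX.stateProb_eq_zero (by omega), mul_zero]
  · rw [Finset.mem_range] at hi
    rw [Nat.add_sub_assoc (by omega)]

theorem tendsto_stateProb [IsProbabilityMeasure P] (hX : IsGFBP P X α k n₀ lam) (hα : 0 < α)
    (hk : 1 ≤ k) (m : ℕ) {t : ℝ} (ht : 0 ≤ t) :
    Filter.Tendsto (fun J => ∑ j ∈ Finset.range J,
      stateCoeff lam n₀ k (fun l => ∑ i ∈ Finset.Icc 1 k, lam (n₀ + l) i) m j *
        ((t ^ α) ^ j / Real.Gamma (j * α + 1)))
      Filter.atTop (nhds (stateProb P X (n₀ + m) t)) := by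
  refine tendsto_of_rlIntegral_system (p := fun m => stateProb P X (n₀ + m)) hα
    (fun m t ht => ?_) (fun m t => ?_) (fun m t ht => ?_) (fun m j => stateCoeff_succ hk j) m ht
  · rcases ht.eq_or_lt with rfl | ht
    · simp
    · have := (hX.absCont (n₀ + m) (Nat.le_add_right _ _) t ht).continuousOn
      rwa [Set.uIcc_of_le ht.le] at this
  · rw [stateProb, abs_of_nonneg measureReal_nonneg]
    exact measureReal_le_one
  · rw [stateCoeff_zero hk]
    exact hX.stateProb_eq_add_rlIntegral hα m ht

theorem stateProb_self [IsProbabilityMeasure P] (hX : IsGFBP P X α k n₀ lam) (hα : 0 < α)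
    (hk : 1 ≤ k) {t : ℝ} (ht : 0 ≤ t) :
    stateProb P X n₀ t = mittagLeffler α 1 (-(∑ i ∈ Finset.Icc 1 k, lam n₀ i) * t ^ α) := by
  refine tendsto_nhds_unique (hX.tendsto_stateProb hα hk 0 ht) ?_
  rw [mittagLeffler]
  refine (summable_pow_div_Gamma hα _).hasSum.tendsto_sum_nat.congr fun J => ?_
  refine Finset.sum_congr rfl fun j _ => ?_
  rw [stateCoeff, if_pos rfl, mul_pow, add_zero, mul_div_assoc]

theorem stateProb_eq_sum_tsum [IsProbabilityMeasure P] (hX : IsGFBP P X α k n₀ lam) (hα : 0 < α)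
    (hk : 1 ≤ k) {m : ℕ} (hm : 1 ≤ m) {t : ℝ} (ht : 0 ≤ t) :
    stateProb P X (n₀ + m) t = ∑ x ∈ Theta m k, rateProd lam n₀ x *
      ∑' j : ℕ, PowerSeries.coeff j (pathSeries Finset.univ (mu lam k n₀ x)) *
        ((t ^ α) ^ j / Real.Gamma (j * α + 1)) := by
  refine tendsto_nhds_unique (hX.tendsto_stateProb hα hk m ht) ?_
  have hsum : ∀ x ∈ Theta m k, HasSum (fun j : ℕ => rateProd lam n₀ x *
      (PowerSeries.coeff j (pathSeries Finset.univ (mu lam k n₀ x)) *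
        ((t ^ α) ^ j / Real.Gamma (j * α + 1)))) _ := fun x _ => by
    have : Nonempty (Fin (mStar x)) := ⟨⟨0, mStar_pos x⟩⟩
    exact (summable_coeff_pathSeries Finset.univ_nonempty _ hα _).hasSum.mul_left _
  refine (hasSum_sum hsum).tendsto_sum_nat.congr fun J => Finset.sum_congr rfl fun j _ => ?_
  rw [stateCoeff, if_neg (by omega), Finset.sum_mul]
  exact Finset.sum_congr rfl fun x _ => by rw [pathSeries_mu, mul_assoc]

end IsGFBP

theorem mu_ne_zero {k n₀ : ℕ} (hk : 1 ≤ k) {lam : ℕ → ℕ → ℝ}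
    (hlam : ∀ n, n₀ ≤ n → ∀ i ∈ Finset.Icc 1 k, 0 < lam n i) {m : ℕ} (x : Fin m → ℕ)
    (l : Fin (mStar x)) : mu lam k n₀ x l ≠ 0 :=
  (Finset.sum_pos (hlam _ (Nat.le_add_right _ _)) ⟨1, Finset.mem_Icc.2 ⟨le_rfl, hk⟩⟩).ne'

theorem theorem2p2 {Ω : Type*} [MeasurableSpace Ω] (P : Measure Ω) [IsProbabilityMeasure P]
    (α : ℝ) (hα₀ : 0 < α) (hα₁ : α ≤ 1) (k n₀ : ℕ) (hk : 1 ≤ k) (lam : ℕ → ℕ → ℝ)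
    (hlam : ∀ n, n₀ ≤ n → ∀ i ∈ Finset.Icc 1 k, 0 < lam n i)
    (X : ℝ≥0 → Ω → ℕ∞) (hX : IsGFBP P X α k n₀ lam) :
    -- the state `n₀`
    (∀ t : ℝ, 0 ≤ t →
      stateProb P X n₀ t = mittagLeffler α 1 (-(∑ i ∈ Finset.Icc 1 k, lam n₀ i) * t ^ α)) ∧
    -- the states `n₀ + m`, in the general case
    (∀ m : ℕ, 1 ≤ m → ∀ t : ℝ, 0 ≤ t →
      (k ≤ m - 1 →
        (∀ x ∈ Theta m k, Summable fun i : Set.Ici (mStar x - 1) =>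
          seriesTerm α t (mu lam k n₀ x) i) ∧
        stateProb P X (n₀ + m) t =
          ∑ x ∈ Theta m k, rateProd lam n₀ x * seriesForm α t (mu lam k n₀ x)) ∧
      (m ≤ k →
        (∀ x ∈ Theta m m, Summable fun i : Set.Ici (mStar x - 1) =>
          seriesTerm α t (mu lam k n₀ x) i) ∧
        stateProb P X (n₀ + m) t =
          ∑ x ∈ Theta m m, rateProd lam n₀ x * seriesForm α t (mu lam k n₀ x))) ∧
    -- the states `n₀ + m`, when the `μ_l` are distinct
    (∀ m : ℕ, 1 ≤ m → ∀ t : ℝ, 0 ≤ t →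
      (k ≤ m - 1 → (∀ x ∈ Theta m k, Function.Injective (mu lam k n₀ x)) →
        stateProb P X (n₀ + m) t =
          ∑ x ∈ Theta m k, rateProd lam n₀ x * distinctForm α t (mu lam k n₀ x)) ∧
      (m ≤ k → (∀ x ∈ Theta m m, Function.Injective (mu lam k n₀ x)) →
        stateProb P X (n₀ + m) t =
          ∑ x ∈ Theta m m, rateProd lam n₀ x * distinctForm α t (mu lam k n₀ x))) := by
  refine ⟨fun t ht => hX.stateProb_self hα₀ hk ht, ?_, ?_⟩
  · intro m hm t ht
    have hsum : ∀ x : Fin m → ℕ, Summable fun i : Set.Ici (mStar x - 1) =>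
        seriesTerm α t (mu lam k n₀ x) i := fun x =>
      (summable_seriesTerm hα₀ (mStar_pos x) t _).subtype _
    have hp : stateProb P X (n₀ + m) t =
        ∑ x ∈ Theta m k, rateProd lam n₀ x * seriesForm α t (mu lam k n₀ x) := by
      rw [hX.stateProb_eq_sum_tsum hα₀ hk hm ht]
      exact Finset.sum_congr rfl fun x _ => by
        rw [seriesForm_eq_tsum (mStar_pos x) (mu_ne_zero hk hlam x)]
    refine ⟨fun _ => ⟨fun x _ => hsum x, hp⟩, fun hmk => ⟨fun x _ => hsum x, ?_⟩⟩
    rw [Theta_congr_of_le le_rfl hmk, hp]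
  · intro m hm t ht
    have hp : (∀ x ∈ Theta m k, Function.Injective (mu lam k n₀ x)) →
        stateProb P X (n₀ + m) t =
          ∑ x ∈ Theta m k, rateProd lam n₀ x * distinctForm α t (mu lam k n₀ x) := by
      intro hinj
      rw [hX.stateProb_eq_sum_tsum hα₀ hk hm ht]
      exact Finset.sum_congr rfl fun x hx => by
        rw [distinctForm_eq_tsum hα₀ (mStar_pos x) (hinj x hx)]
    refine ⟨fun _ => hp, fun hmk => ?_⟩
    rw [Theta_congr_of_le le_rfl hmk]
    exact hp
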